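/- Consider a finite Markov decision process with non-sink states $\mathcal S=\{1,\dots,S\}$, an additional sink state $e$, state space $\bar{\mathcal S}=\mathcal S\cup\{e\}$, a finite nonempty action set $\mathcal A$, transition probabilities $\bar p(s,a,s')$, rewards $\bar r(s,a,s')\in\mathbb R$, and initial distribution $\bar\mu$ on $\bar{\mathcal S}$. Assume that $\bar p(e,a,e)=1$ and $\bar r(e,a,e)=0$ for all $a\in\mathcal A$, that $\bar\mu_e=0$, and that $\bar\mu_s>0$ for every $s\in\mathcal S$. Let $\Pi_{\mathrm{HR}}$ be the set of history-dependent randomized policies, that is, sequences $(\pi_t)_{t\ge 0}$ where $\pi_t$ maps each history $(s_0,a_0,s_1,\dots,a_{t-1},s_t)$ to a probability distribution on $\mathcal A$, and let $\Pi_{\mathrm{SD}}\subseteq\Pi_{\mathrm{HR}}$ be the stationary deterministic policies, given by functions from states to actions. Assume that the process is transient: for every $\pi\in\Pi_{\mathrm{SD}}$ and all $s,s'\in\mathcal S$, \[ \sum_{t=0}^{\infty}\mathbb P^{\pi,s}[\tilde s_t=s']<\infty , \] where $\mathbb P^{\pi,s}$ is the law of the process started in $s$ and controlled by $\pi$. For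 $\alpha\in(0,1)$ the entropic value at risk of a random variable $\tilde x$ is \[ \mathrm{EVaR}_\alpha[\tilde x]=\sup_{\beta>0}\Bigl(-\beta^{-1}\log \mathbb E\bigl[e^{-\beta\tilde x}\bigr]+\beta^{-1}\log\alpha\Bigr). \] Then for every $\alpha\in(0,1)$ there exists $\pi^\star\in\Pi_{\mathrm{SD}}$ such that \[ \liminf_{t\to\infty}\mathrm{EVaR}_\alpha^{\pi^\star,\bar\mu}\Bigl[\sum_{k=0}^{t}\bar r(\tilde s_k,\tilde a_k,\tilde s_{k+1})\Bigr] =\sup_{\pi\in\Pi_{\mathrm{HR}}}\ \liminf_{t\to\infty}\mathrm{EVaR}_\alpha^{\pi,\bar\mu}\Bigl[\sum_{k=0}^{t}\bar r(\tilde s_k,\tilde a_k,\tilde s_{k+1})\Bigr], \] where the limits inferior and the supremum over policies are taken in $[-\infty,\infty]$ and the superscripts $\pi,\bar\mu$ indicate that the process has initial distribution $\bar\mu$ and is controlled by $\pi$. -/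

import Mathlib

open Filter

noncomputable section

namespace TRC

/-! ### Risk measures on finite probability spaces -/

/-- Expectation of `X` under the probability vector `q` on the finite sample space `Ω`. -/
def expect {Ω : Type*} [Fintype Ω] (q : stdSimplex ℝ Ω) (X : Ω → ℝ) : ℝ :=
  ∑ ω, q ω * X ω

/-- Entropic risk measure at level `β > 0`: `- β⁻¹ log E[exp (-β X)]`. -/
def erm {Ω : Type*} [Fintype Ω] (β : ℝ) (q : stdSimplex ℝ Ω) (X : Ω → ℝ) : ℝ :=
  -β⁻¹ * Real.log (expect q fun ω => Real.exp (-β * X ω))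

/-- Entropic value at risk at level `α ∈ (0, 1)`: `sup_{β > 0} (ERM_β[X] + β⁻¹ log α)`,
the supremum being taken in the extended reals. -/
def evar {Ω : Type*} [Fintype Ω] (α : ℝ) (q : stdSimplex ℝ Ω) (X : Ω → ℝ) : EReal :=
  ⨆ β : {b : ℝ // 0 < b}, ((erm β.1 q X + β.1⁻¹ * Real.log α : ℝ) : EReal)

/-! ### Markov decision processes with a sink -/

/-- A finite MDP with non-sink states `S`, sink state `none`, full state space `Option S`, and
actions `A`. -/
structure SinkMDP (S A : Type*) [Fintype S] where
  /-- `p s a s'` is the probability of moving to `s'` when action `a` is taken in `s`. -/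
  p : Option S → A → stdSimplex ℝ (Option S)
  /-- `r s a s'` is the reward for moving from `s` to `s'` under action `a`. -/
  r : Option S → A → Option S → ℝ
  /-- The initial state distribution. -/
  μ : stdSimplex ℝ (Option S)
  p_sink : ∀ a, p none a none = 1
  r_sink : ∀ a, r none a none = 0
  μ_sink : μ none = 0

/-- Histories `(s₀, a₀, s₁, …, a_{t-1}, s_t)` with `t` transitions. -/
inductive Hist (S A : Type*) : ℕ → Type _
  | init (s : Option S) : Hist S A 0
  | step {t : ℕ} (h : Hist S A t) (a : A) (s' : Option S) : Hist S A (t + 1)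

namespace Hist

/-- A history without transitions is a state. -/
def equivZero (S A : Type*) : Option S ≃ Hist S A 0 where
  toFun s := .init s
  invFun h := match h with | .init s => s
  left_inv _ := rfl
  right_inv h := by cases h; rfl

/-- A history with `t + 1` transitions is a history with `t` transitions together with one more
action and one more state. -/
def equivSucc (S A : Type*) (t : ℕ) : Hist S A t × A × Option S ≃ Hist S A (t + 1) where
  toFun x := .step x.1 x.2.1 x.2.2
  invFun h := match h with | .step h a s' => (h, a, s')
  left_inv _ := rfl
  right_inv h := by cases h; rfl

instance instFintype (S A : Type*) [Fintype S] [Fintype A] : (t : ℕ) → Fintype (Hist S A t)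
  | 0 => Fintype.ofEquiv _ (equivZero S A)
  | t + 1 =>
    have := instFintype S A t
    Fintype.ofEquiv _ (equivSucc S A t)

theorem sum_zero {S A : Type*} [Fintype S] [Fintype A] (f : Hist S A 0 → ℝ) :
    ∑ h, f h = ∑ s, f (.init s) :=
  ((equivZero S A).sum_comp f).symm

theorem sum_succ {S A : Type*} [Fintype S] [Fintype A] {t : ℕ} (f : Hist S A (t + 1) → ℝ) :
    ∑ h, f h = ∑ h : Hist S A t, ∑ a, ∑ s', f (.step h a s') := by
  rw [← (equivSucc S A t).sum_comp f, Fintype.sum_prod_type]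
  refine Finset.sum_congr rfl fun h _ => ?_
  rw [Fintype.sum_prod_type]
  rfl

/-- The last state `s_t` of a history. -/
def last {S A : Type*} : {t : ℕ} → Hist S A t → Option S
  | _, .init s => s
  | _, .step _ _ s' => s'

end Hist

/-- History-dependent randomized policies with infinite horizon. -/
abbrev HRPolicy (S A : Type*) [Fintype A] : Type _ :=
  (t : ℕ) → Hist S A t → stdSimplex ℝ A

/-- The stationary deterministic policy that takes action `d s` in state `s`. -/
def stationary {S A : Type*} [Fintype A] [DecidableEq A] (d : Option S → A) : HRPolicy S A :=
  fun _ h => stdSimplex.vertex (d h.last)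

namespace SinkMDP

variable {S A : Type*} [Fintype S] [Fintype A]

/-- Probability of a history under policy `π` from the initial distribution `η`:
`η(s₀) ∏_k π_k(a_k | s₀, …, s_k) p(s_k, a_k, s_{k+1})`. -/
def histProb (M : SinkMDP S A) (π : HRPolicy S A) (η : stdSimplex ℝ (Option S)) :
    {t : ℕ} → Hist S A t → ℝ
  | _, .init s => η s
  | _, .step (t := t) h a s' => histProb M π η h * π t h a * M.p h.last a s'

theorem histProb_nonneg (M : SinkMDP S A) (π : HRPolicy S A) (η : stdSimplex ℝ (Option S))
    {t : ℕ} (h : Hist S A t) : 0 ≤ M.histProb π η h := by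
  induction h with
  | init s => exact stdSimplex.zero_le η s
  | step h a s' ih =>
    exact mul_nonneg (mul_nonneg ih (stdSimplex.zero_le _ _)) (stdSimplex.zero_le _ _)

theorem sum_histProb (M : SinkMDP S A) (π : HRPolicy S A) (η : stdSimplex ℝ (Option S))
    (t : ℕ) : ∑ h : Hist S A t, M.histProb π η h = 1 := by
  induction t with
  | zero => rw [Hist.sum_zero]; exact stdSimplex.sum_eq_one η
  | succ t ih =>
    rw [Hist.sum_succ, ← ih]
    refine Finset.sum_congr rfl fun h _ => ?_
    simp only [histProb, ← Finset.mul_sum, stdSimplex.sum_eq_one, mul_one]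

/-- The law of the history up to time `t` under policy `π` and initial distribution `η`. -/
def law (M : SinkMDP S A) (π : HRPolicy S A) (η : stdSimplex ℝ (Option S)) (t : ℕ) :
    stdSimplex ℝ (Hist S A t) :=
  ⟨fun h => M.histProb π η h, fun h => M.histProb_nonneg π η h, M.sum_histProb π η t⟩

/-- Probability that the state at time `t` is `s'`. -/
def stateProb [DecidableEq S] (M : SinkMDP S A) (π : HRPolicy S A)
    (η : stdSimplex ℝ (Option S)) (t : ℕ) (s' : Option S) : ℝ :=
  expect (M.law π η t) fun h => if h.last = s' then 1 else 0

/-- Transience: under every stationary deterministic policy and from every non-sink state, the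
expected total number of visits to every non-sink state is finite. -/
def IsTransient [DecidableEq S] [DecidableEq A] (M : SinkMDP S A) : Prop :=
  ∀ (d : Option S → A) (s s' : S),
    Summable fun t : ℕ => M.stateProb (stationary d) (stdSimplex.vertex (some s)) t (some s')

/-- Total reward `∑_{k < t} r(s_k, a_k, s_{k+1})` collected along a history with `t`
transitions. -/
def totalReward (M : SinkMDP S A) : {t : ℕ} → Hist S A t → ℝ
  | _, .init _ => 0
  | _, .step h a s' => totalReward M h + M.r h.last a s'

/-- The EVaR total reward objective
`liminf_{t → ∞} EVaR_α^{π, μ} [∑_{k = 0}^{t} r(s_k, a_k, s_{k+1})]` of a policy. -/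
def evarObjective (M : SinkMDP S A) (α : ℝ) (π : HRPolicy S A) : EReal :=
  liminf (fun t : ℕ =>
    evar α (M.law π M.μ (t + 1)) fun h : Hist S A (t + 1) => M.totalReward h) atTop

end SinkMDP

end TRC

end

namespace TRC

/-! ### Properties of the risk measures -/

section Risk

variable {Ω : Type*} [Fintype Ω] (q : stdSimplex ℝ Ω)

/-! There are finitely many stationary deterministic policies, so it suffices that a real number
`c'` above all their objectives bounds every objective up to an arbitrarily small gap.

Fix `β`. Maximizing ERM means minimizing `E[exp (-β X_t)]`, which is at least the same expectation
restricted to paths absorbed by time `t`, hence at least value iteration started from `sinkInd`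
(`le_tilted`). That iteration is increasing whatever the signs of the rewards. If it diverges, the
ERM of every policy tends to `-∞`. Otherwise a policy greedy for the limit has convergent
exponential values below that limit (`exists_policy_tendsto`), so its ERM is asymptotically at least
as good as that of any policy.

Exchanging the supremum over `β` with the limit inferior needs finitely many levels. Transience
gives a Lyapunov function by policy improvement, hence a uniform upper bound on expected total
rewards. With it, `exists_finset_evar_le` reduces EVaR to finitely many `β`, at the cost of the gap.
-/

theorem expect_mono {X Y : Ω → ℝ} (h : ∀ ω, X ω ≤ Y ω) : expect q X ≤ expect q Y :=
  Finset.sum_le_sum fun ω _ => mul_le_mul_of_nonneg_left (h ω) (stdSimplex.zero_le q ω)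

theorem expect_exp_pos (X : Ω → ℝ) : 0 < expect q fun ω => Real.exp (X ω) := by
  obtain ⟨ω, -, hω⟩ : ∃ ω ∈ Finset.univ, (0 : ℝ) < q ω := by
    apply Finset.exists_lt_of_sum_lt
    simp [stdSimplex.sum_eq_one q]
  exact Finset.sum_pos' (fun ω _ => mul_nonneg (stdSimplex.zero_le q ω) (Real.exp_pos _).le)
    ⟨ω, Finset.mem_univ ω, mul_pos hω (Real.exp_pos _)⟩

/-- The entropic risk measure is bounded above by the expectation. -/
theorem erm_le_expect {β : ℝ} (hβ : 0 < β) (X : Ω → ℝ) : erm β q X ≤ expect q X := by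
  have h1 : Real.exp (-β * expect q X) ≤ expect q fun ω => Real.exp (-β * X ω) := by
    have := convexOn_exp.map_sum_le (t := Finset.univ) (w := fun ω => q ω)
      (p := fun ω => -β * X ω) (fun ω _ => stdSimplex.zero_le q ω) (stdSimplex.sum_eq_one q)
      (fun _ _ => Set.mem_univ _)
    simp only [smul_eq_mul] at this
    unfold expect
    rw [Finset.mul_sum]
    refine le_trans (le_of_eq ?_) this
    exact congrArg Real.exp (Finset.sum_congr rfl fun ω _ => by ring)
  have h2 := (Real.le_log_iff_exp_le (expect_exp_pos q _)).2 h1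
  have h3 := mul_le_mul_of_nonneg_left h2 (inv_pos.2 hβ).le
  rw [neg_mul, mul_neg, inv_mul_cancel_left₀ hβ.ne'] at h3
  unfold erm
  linarith

/-- The entropic risk measure is antitone in the risk level. -/
theorem erm_antitone {β γ : ℝ} (hβ : 0 < β) (h : β ≤ γ) (X : Ω → ℝ) :
    erm γ q X ≤ erm β q X := by
  have hγ : 0 < γ := hβ.trans_le h
  have h1 := Real.rpow_arith_mean_le_arith_mean_rpow Finset.univ (fun ω => q ω)
    (fun ω => Real.exp (-β * X ω)) (fun ω _ => stdSimplex.zero_le q ω)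
    (stdSimplex.sum_eq_one q) (fun ω _ => (Real.exp_pos _).le) ((one_le_div hβ).2 h)
  have h2 : ∀ ω, Real.exp (-β * X ω) ^ (γ / β) = Real.exp (-γ * X ω) := fun ω => by
    rw [← Real.exp_mul]
    congr 1
    field_simp
  simp only [h2] at h1
  have hpos := expect_exp_pos q fun ω => -β * X ω
  have h3 := Real.log_le_log (Real.rpow_pos_of_pos hpos _) h1
  rw [Real.log_rpow hpos] at h3
  have h4 := mul_le_mul_of_nonneg_left h3 (inv_pos.2 hγ).le
  unfold erm
  have h5 : γ⁻¹ * (γ / β * Real.log (expect q fun ω => Real.exp (-β * X ω)))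
      = β⁻¹ * Real.log (expect q fun ω => Real.exp (-β * X ω)) := by
    field_simp
  rw [h5] at h4
  change _ ≤ γ⁻¹ * Real.log (expect q fun ω => Real.exp (-γ * X ω)) at h4
  linarith

end Risk

namespace SinkMDP

/-! ### Exponentially tilted transition operators -/

section Operators

variable {S A : Type*} [Fintype S] (M : SinkMDP S A)

/-- The exponentially tilted transition operator of the action `a`. -/
noncomputable def tiltOp (β : ℝ) (a : A) (f : Option S → ℝ) (s : Option S) : ℝ :=
  ∑ s', M.p s a s' * (Real.exp (-β * M.r s a s') * f s')

/-- The exponentially tilted transition operator of the stationary policy `d`. -/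
noncomputable def policyOp (β : ℝ) (d : Option S → A) (f : Option S → ℝ) : Option S → ℝ :=
  fun s => M.tiltOp β (d s) f s

/-- The exponential Bellman operator, minimizing over the actions. -/
noncomputable def bellmanOp (β : ℝ) (f : Option S → ℝ) : Option S → ℝ :=
  fun s => ⨅ a, M.tiltOp β a f s

theorem tiltOp_mono (β : ℝ) (a : A) {f g : Option S → ℝ} (h : f ≤ g) (s : Option S) :
    M.tiltOp β a f s ≤ M.tiltOp β a g s :=
  Finset.sum_le_sum fun s' _ => mul_le_mul_of_nonneg_left
    (mul_le_mul_of_nonneg_left (h s') (Real.exp_pos _).le) (stdSimplex.zero_le _ s')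

theorem tiltOp_nonneg (β : ℝ) (a : A) {f : Option S → ℝ} (h : 0 ≤ f) (s : Option S) :
    0 ≤ M.tiltOp β a f s :=
  Finset.sum_nonneg fun s' _ => mul_nonneg (stdSimplex.zero_le _ s')
    (mul_nonneg (Real.exp_pos _).le (h s'))

theorem p_sink_some (a : A) (s : S) : M.p none a (some s) = 0 := by
  have h := stdSimplex.sum_eq_one (M.p none a)
  rw [Fintype.sum_option, M.p_sink] at h
  have h' : ∑ s, M.p none a (some s) = 0 := by linarith
  exact (Finset.sum_eq_zero_iff_of_nonneg fun s _ => stdSimplex.zero_le _ _).1 h' s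
    (Finset.mem_univ s)

theorem tiltOp_none (β : ℝ) (a : A) (f : Option S → ℝ) : M.tiltOp β a f none = f none := by
  simp [tiltOp, Fintype.sum_option, M.p_sink, M.r_sink, M.p_sink_some]

theorem tiltOp_zero_eq_expect (a : A) (f : Option S → ℝ) (s : Option S) :
    M.tiltOp 0 a f s = expect (M.p s a) f := by
  simp [tiltOp, expect]

theorem tiltOp_add (β : ℝ) (a : A) (f g : Option S → ℝ) (s : Option S) :
    M.tiltOp β a (f + g) s = M.tiltOp β a f s + M.tiltOp β a g s := by
  simp only [tiltOp, Pi.add_apply, mul_add, Finset.sum_add_distrib]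

theorem tiltOp_smul (β : ℝ) (a : A) (c : ℝ) (f : Option S → ℝ) (s : Option S) :
    M.tiltOp β a (c • f) s = c * M.tiltOp β a f s := by
  simp only [tiltOp, Pi.smul_apply, smul_eq_mul, Finset.mul_sum]
  exact Finset.sum_congr rfl fun s' _ => by ring

theorem tendsto_tiltOp (β : ℝ) (a : A) (s : Option S) {f : ℕ → Option S → ℝ}
    {g : Option S → ℝ} (h : ∀ s, Tendsto (fun t => f t s) atTop (nhds (g s))) :
    Tendsto (fun t => M.tiltOp β a (f t) s) atTop (nhds (M.tiltOp β a g s)) :=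
  tendsto_finsetSum _ fun s' _ => ((h s').const_mul _).const_mul _

theorem policyOp_mono (β : ℝ) (d : Option S → A) : Monotone (M.policyOp β d) :=
  fun _ _ h s => M.tiltOp_mono β (d s) h s

theorem policyOp_add (β : ℝ) (d : Option S → A) (f g : Option S → ℝ) :
    M.policyOp β d (f + g) = M.policyOp β d f + M.policyOp β d g :=
  funext fun s => M.tiltOp_add β (d s) f g s

theorem policyOp_smul (β : ℝ) (d : Option S → A) (c : ℝ) (f : Option S → ℝ) :
    M.policyOp β d (c • f) = c • M.policyOp β d f :=
  funext fun s => M.tiltOp_smul β (d s) c f s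

theorem iterate_policyOp_add (β : ℝ) (d : Option S → A) (f g : Option S → ℝ) (t : ℕ) :
    (M.policyOp β d)^[t] (f + g) = (M.policyOp β d)^[t] f + (M.policyOp β d)^[t] g := by
  induction t with
  | zero => rfl
  | succ t ih => simp only [Function.iterate_succ_apply', ih, policyOp_add]

theorem iterate_policyOp_smul (β : ℝ) (d : Option S → A) (c : ℝ) (f : Option S → ℝ) (t : ℕ) :
    (M.policyOp β d)^[t] (c • f) = c • (M.policyOp β d)^[t] f := by
  induction t with
  | zero => rfl
  | succ t ih => simp only [Function.iterate_succ_apply', ih, policyOp_smul]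

theorem iterate_policyOp_none (β : ℝ) (d : Option S → A) (f : Option S → ℝ) (t : ℕ) :
    (M.policyOp β d)^[t] f none = f none := by
  induction t with
  | zero => rfl
  | succ t ih => rw [Function.iterate_succ_apply', ← ih]; exact M.tiltOp_none β _ _

variable [Finite A]

theorem bellmanOp_le_tiltOp (β : ℝ) (a : A) (f : Option S → ℝ) (s : Option S) :
    M.bellmanOp β f s ≤ M.tiltOp β a f s :=
  ciInf_le (Set.finite_range _).bddBelow a

variable [Nonempty A]

theorem exists_tiltOp_eq_bellmanOp (β : ℝ) (f : Option S → ℝ) (s : Option S) :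
    ∃ a, M.tiltOp β a f s = M.bellmanOp β f s :=
  exists_eq_ciInf_of_finite

theorem bellmanOp_mono (β : ℝ) : Monotone (M.bellmanOp β) := fun f g h s => by
  obtain ⟨a, ha⟩ := M.exists_tiltOp_eq_bellmanOp β g s
  exact (M.bellmanOp_le_tiltOp β a f s).trans ((M.tiltOp_mono β a h s).trans ha.le)

end Operators

/-! ### Exponentially tilted expectations along histories -/

section Law

variable {S A : Type*} [Fintype S] [Fintype A] (M : SinkMDP S A)

theorem expect_law_zero (π : HRPolicy S A) (η : stdSimplex ℝ (Option S)) (g : Hist S A 0 → ℝ) :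
    expect (M.law π η 0) g = expect η fun s => g (.init s) :=
  Hist.sum_zero _

theorem expect_law_succ (π : HRPolicy S A) (η : stdSimplex ℝ (Option S)) (t : ℕ)
    (g : Hist S A (t + 1) → ℝ) :
    expect (M.law π η (t + 1)) g =
      expect (M.law π η t) fun h => expect (π t h) fun a => expect (M.p h.last a) fun s' =>
        g (.step h a s') := by
  unfold expect
  rw [Hist.sum_succ]
  refine Finset.sum_congr rfl fun h _ => ?_
  simp only [Finset.mul_sum]
  refine Finset.sum_congr rfl fun a _ => Finset.sum_congr rfl fun s' _ => ?_
  change M.histProb π η h * π t h a * M.p h.last a s' * _ = M.histProb π η h * _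
  ring

/-- The expectation of `exp (-β X_t) f(s_t)`, where `X_t` is the total reward. -/
noncomputable def tilted (β : ℝ) (π : HRPolicy S A) (η : stdSimplex ℝ (Option S)) (t : ℕ)
    (f : Option S → ℝ) : ℝ :=
  expect (M.law π η t) fun h => Real.exp (-β * M.totalReward h) * f h.last

theorem tilted_zero (β : ℝ) (π : HRPolicy S A) (η : stdSimplex ℝ (Option S))
    (f : Option S → ℝ) : M.tilted β π η 0 f = expect η f := by
  simp [tilted, expect_law_zero, totalReward, Hist.last]

theorem tilted_succ (β : ℝ) (π : HRPolicy S A) (η : stdSimplex ℝ (Option S)) (t : ℕ)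
    (f : Option S → ℝ) :
    M.tilted β π η (t + 1) f = expect (M.law π η t) fun h =>
      Real.exp (-β * M.totalReward h) * expect (π t h) fun a => M.tiltOp β a f h.last := by
  unfold tilted
  rw [expect_law_succ]
  congr 1
  funext h
  simp only [expect, tiltOp, Finset.mul_sum]
  refine Finset.sum_congr rfl fun a _ => Finset.sum_congr rfl fun s' _ => ?_
  simp only [totalReward, Hist.last, mul_add, Real.exp_add]
  ring

theorem tilted_mono (β : ℝ) (π : HRPolicy S A) (η : stdSimplex ℝ (Option S)) (t : ℕ)
    {f g : Option S → ℝ} (h : f ≤ g) : M.tilted β π η t f ≤ M.tilted β π η t g :=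
  expect_mono _ fun _ => mul_le_mul_of_nonneg_left (h _) (Real.exp_pos _).le

theorem expect_const {Ω : Type*} [Fintype Ω] (q : stdSimplex ℝ Ω) (c : ℝ) :
    expect q (fun _ => c) = c := by
  rw [expect, ← Finset.sum_mul, stdSimplex.sum_eq_one, one_mul]

theorem expect_vertex {Ω : Type*} [Fintype Ω] [DecidableEq Ω] (ω : Ω) (X : Ω → ℝ) :
    expect (stdSimplex.vertex ω) X = X ω := by
  rw [expect, Finset.sum_eq_single ω] <;> simp +contextual [stdSimplex.vertex_coe]

theorem tilted_stationary [DecidableEq A] (β : ℝ) (d : Option S → A)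
    (η : stdSimplex ℝ (Option S)) (t : ℕ) (f : Option S → ℝ) :
    M.tilted β (stationary d) η t f = expect η ((M.policyOp β d)^[t] f) := by
  induction t generalizing f with
  | zero => exact M.tilted_zero β _ η f
  | succ t ih =>
    rw [tilted_succ, Function.iterate_succ_apply, ← ih]
    simp only [stationary, expect_vertex]
    rfl

/-- An average over actions is at least the minimum over actions, so neither randomization nor
memory helps. The last transition of the history is the innermost operator, hence the induction over
all `f`. -/
theorem le_tilted [Nonempty A] (β : ℝ) (π : HRPolicy S A)
    (η : stdSimplex ℝ (Option S)) (t : ℕ) (f : Option S → ℝ) :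
    expect η ((M.bellmanOp β)^[t] f) ≤ M.tilted β π η t f := by
  induction t generalizing f with
  | zero => exact (M.tilted_zero β _ η f).ge
  | succ t ih =>
    rw [tilted_succ, Function.iterate_succ_apply]
    refine (ih _).trans (expect_mono _ fun h => ?_)
    refine mul_le_mul_of_nonneg_left ?_ (Real.exp_pos _).le
    rw [← expect_const (π t h) (M.bellmanOp β f h.last)]
    exact expect_mono _ fun a => M.bellmanOp_le_tiltOp β a f _

theorem erm_law (β : ℝ) (π : HRPolicy S A) (η : stdSimplex ℝ (Option S)) (t : ℕ) :
    erm β (M.law π η t) (fun h => M.totalReward h) =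
      -β⁻¹ * Real.log (M.tilted β π η t 1) := by
  simp [erm, tilted]

end Law

/-! ### A Lyapunov function for transient processes -/

/-- The indicator function of the sink. -/
def sinkInd {S : Type*} : Option S → ℝ := fun s => s.elim 1 fun _ => 0

/-- The indicator function of the non-sink states. -/
def nonSinkInd {S : Type*} : Option S → ℝ := fun s => s.elim 0 fun _ => 1

theorem sinkInd_add_nonSinkInd {S : Type*} : (sinkInd + nonSinkInd : Option S → ℝ) = 1 := by
  funext s
  cases s <;> simp [sinkInd, nonSinkInd]

section Lyapunov

variable {S A : Type*} [Fintype S] [DecidableEq S] [Fintype A] [DecidableEq A]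
  {M : SinkMDP S A}

/-- At `β = 0` the iterate is the probability of being outside the sink at time `t`, a finite sum of
visit probabilities. -/
theorem IsTransient.summable_iterate (hM : M.IsTransient) (d : Option S → A) (s : Option S) :
    Summable fun t => (M.policyOp 0 d)^[t] nonSinkInd s := by
  cases s with
  | none => simp [iterate_policyOp_none, nonSinkInd, summable_zero]
  | some s =>
    refine (summable_sum fun s' (_ : s' ∈ Finset.univ) => hM d s s').congr fun t => ?_
    rw [← expect_vertex (some s) ((M.policyOp 0 d)^[t] nonSinkInd), ← tilted_stationary]
    simp only [tilted, stateProb, expect]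
    rw [Finset.sum_comm]
    refine Finset.sum_congr rfl fun h _ => ?_
    rw [← Finset.mul_sum]
    cases h.last <;> simp [nonSinkInd]

/-- A function that decreases in expectation by at least one per step spent outside the sink,
whatever the action. -/
theorem IsTransient.exists_lyapunov (hM : M.IsTransient) [Nonempty A] :
    ∃ v : Option S → ℝ, v none = 0 ∧ 0 ≤ v ∧
      ∀ (s : S) (a : A), 1 + M.tiltOp 0 a v (some s) ≤ v (some s) := by
  have hsum := hM.summable_iterate
  set V : (Option S → A) → Option S → ℝ :=
    fun d s => ∑' t, (M.policyOp 0 d)^[t] nonSinkInd s with hV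
  have hVnone : ∀ d, V d none = 0 := fun d => by
    simp [hV, iterate_policyOp_none, nonSinkInd]
  have hJ : ∀ d t, 0 ≤ (M.policyOp 0 d)^[t] nonSinkInd := fun d t => by
    induction t with
    | zero => intro s; cases s <;> simp [nonSinkInd]
    | succ t ih => rw [Function.iterate_succ_apply']; exact fun s => M.tiltOp_nonneg 0 _ ih s
  have hV0 : ∀ d, 0 ≤ V d := fun d s => tsum_nonneg fun t => hJ d t s
  have hfix : ∀ d s, V d s = nonSinkInd s + M.tiltOp 0 (d s) (V d) s := fun d s => by
    have h1 : V d s = _ := (hsum d s).tsum_eq_zero_add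
    rw [h1]
    congr 1
    simp only [Function.iterate_succ_apply', tiltOp, hV, ← tsum_mul_left]
    rw [← Summable.tsum_finsetSum fun s' _ => ((hsum d s').mul_left _).mul_left _]
    rfl
  -- Comparison principle: iterating the inequality leaves a remainder `C` times the survival
  -- probability, which vanishes as the term of a convergent series.
  have hcmp : ∀ (d : Option S → A) (u : Option S → ℝ), u none = 0 →
      (∀ s, u s ≤ nonSinkInd s + M.tiltOp 0 (d s) u s) → u ≤ V d := by
    intro d u hu0 hu
    obtain ⟨C, hC⟩ : ∃ C, ∀ s, |u s| ≤ C := by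
      obtain ⟨C, hC⟩ := (Set.finite_range fun s => |u s|).bddAbove
      exact ⟨C, fun s => hC ⟨s, rfl⟩⟩
    have hstep : ∀ t, u ≤ V d + C • (M.policyOp 0 d)^[t] nonSinkInd := by
      intro t
      induction t with
      | zero =>
        intro s
        cases s with
        | none => simp [hu0, hVnone, nonSinkInd]
        | some s =>
          have h1 := (abs_le.1 (hC (some s))).2
          have h2 := hV0 d (some s)
          simp only [Pi.zero_apply] at h2
          simp only [Function.iterate_zero, id, Pi.add_apply, Pi.smul_apply, smul_eq_mul,
            nonSinkInd, Option.elim_some]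
          linarith
      | succ t ih =>
        intro s
        have h1 := M.tiltOp_mono 0 (d s) ih s
        rw [tiltOp_add, tiltOp_smul] at h1
        have h2 := hu s
        have h3 := hfix d s
        rw [Function.iterate_succ_apply']
        simp only [Pi.add_apply, Pi.smul_apply, smul_eq_mul, policyOp]
        linarith
    intro s
    have hlim : Tendsto (fun t => V d s + C * (M.policyOp 0 d)^[t] nonSinkInd s) atTop
        (nhds (V d s + C * 0)) :=
      ((hsum d s).tendsto_atTop_zero.const_mul C).const_add _
    rw [mul_zero, add_zero] at hlim
    exact ge_of_tendsto' hlim fun t => hstep t s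
  -- Policy improvement: a violation at `(s, a)` would let the policy switched to `a` at `s` have a
  -- strictly larger sum of values.
  obtain ⟨d, hd⟩ := Finite.exists_max fun d => ∑ s, V d s
  refine ⟨V d, hVnone d, hV0 d, fun s a => ?_⟩
  by_contra! hlt
  set d' := Function.update d (some s) a with hd'
  have himp : ∀ x, V d x ≤ nonSinkInd x + M.tiltOp 0 (d' x) (V d) x := fun x => by
    by_cases hx : x = some s
    · subst hx
      simpa [hd', nonSinkInd] using hlt.le
    · rw [hd', Function.update_of_ne hx]
      exact (hfix d x).le
  have hle := hcmp d' (V d) (hVnone d) himp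
  have hlt' : V d (some s) < V d' (some s) := by
    have h1 := M.tiltOp_mono 0 a hle (some s)
    have h2 := hfix d' (some s)
    simp only [hd', Function.update_self, nonSinkInd, Option.elim_some] at h2
    simp only [hd'] at h1 ⊢
    linarith
  exact absurd (hd d') (not_le.2
    (Finset.sum_lt_sum (fun x _ => hle x) ⟨some s, Finset.mem_univ _, hlt'⟩))

/-- Expected total rewards of a transient process are bounded above, uniformly over all policies
and horizons. -/
theorem IsTransient.exists_expect_totalReward_le (hM : M.IsTransient) [Nonempty A]
    (η : stdSimplex ℝ (Option S)) :
    ∃ C : ℝ, ∀ (π : HRPolicy S A) (t : ℕ),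
      expect (M.law π η t) (fun h => M.totalReward h) ≤ C := by
  obtain ⟨v, hv0, hv, hstep⟩ := hM.exists_lyapunov
  obtain ⟨R, hR⟩ : ∃ R, ∀ s a s', M.r s a s' ≤ R := by
    obtain ⟨R, hR⟩ := (Set.finite_range
      fun x : Option S × A × Option S => M.r x.1 x.2.1 x.2.2).bddAbove
    exact ⟨R, fun s a s' => hR ⟨(s, a, s'), rfl⟩⟩
  have hR0 : 0 ≤ R := by
    have := hR none (Classical.arbitrary A) none
    rwa [M.r_sink] at this
  have hone : ∀ s a, expect (M.p s a) (fun s' => M.r s a s' + R * v s') ≤ R * v s := by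
    intro s a
    cases s with
    | none => simp [expect, Fintype.sum_option, M.p_sink, M.r_sink, M.p_sink_some]
    | some s =>
      have h1 : expect (M.p (some s) a) (fun s' => M.r (some s) a s' + R * v s') ≤
          expect (M.p (some s) a) (fun s' => R + R * v s') :=
        expect_mono _ fun s' => by linarith [hR (some s) a s']
      have h2 : expect (M.p (some s) a) (fun s' => R + R * v s') =
          R * (1 + M.tiltOp 0 a v (some s)) := by
        rw [tiltOp_zero_eq_expect, mul_add, mul_one]
        simp only [expect, mul_add, Finset.sum_add_distrib, ← Finset.sum_mul,
          stdSimplex.sum_eq_one, one_mul, Finset.mul_sum, mul_left_comm]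
      exact h1.trans (h2.le.trans (mul_le_mul_of_nonneg_left (hstep s a) hR0))
  refine ⟨expect η fun s => R * v s, fun π t => ?_⟩
  -- By `hone`, total reward plus `R * v` of the current state is a supermartingale under every
  -- policy.
  have hmain : ∀ t, expect (M.law π η t) (fun h => M.totalReward h + R * v h.last) ≤
      expect η fun s => R * v s := by
    intro t
    induction t with
    | zero => simp [expect_law_zero, totalReward, Hist.last]
    | succ t ih =>
      rw [expect_law_succ]
      refine le_trans (expect_mono _ fun h => ?_) ih
      rw [← expect_const (π t h) (M.totalReward h + R * v h.last)]
      refine expect_mono _ fun a => ?_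
      have h1 : expect (M.p h.last a) (fun s' => M.totalReward (Hist.step h a s') +
          R * v (Hist.step h a s').last) = M.totalReward h +
          expect (M.p h.last a) (fun s' => M.r h.last a s' + R * v s') := by
        simp only [totalReward, Hist.last, add_assoc]
        simp only [expect, mul_add, Finset.sum_add_distrib, ← Finset.sum_mul,
          stdSimplex.sum_eq_one, one_mul]
      rw [h1]
      linarith [hone h.last a]
  refine le_trans (expect_mono _ fun h => ?_) (hmain t)
  have := mul_nonneg hR0 (hv h.last)
  linarith

end Lyapunov

/-! ### Exponential value iteration -/

section ValueIteration

variable {S A : Type*} [Fintype S]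

/-- Equality at the absorbing sink, nonnegativity elsewhere. Starting from the constant `1` instead,
this could fail for positive rewards. -/
theorem sinkInd_le_tiltOp (M : SinkMDP S A) (β : ℝ) (a : A) (s : Option S) :
    sinkInd s ≤ M.tiltOp β a sinkInd s := by
  cases s with
  | none => rw [tiltOp_none]
  | some s => exact M.tiltOp_nonneg β a (fun s => by cases s <;> simp [sinkInd]) _

theorem monotone_iterate_policyOp (M : SinkMDP S A) (β : ℝ) (d : Option S → A) :
    Monotone fun t => (M.policyOp β d)^[t] sinkInd :=
  (M.policyOp_mono β d).monotone_iterate_of_le_map fun s => M.sinkInd_le_tiltOp β (d s) s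

theorem monotone_iterate_bellmanOp [Finite A] [Nonempty A] (M : SinkMDP S A) (β : ℝ) :
    Monotone fun t => (M.bellmanOp β)^[t] sinkInd :=
  (M.bellmanOp_mono β).monotone_iterate_of_le_map fun s => by
    obtain ⟨a, ha⟩ := M.exists_tiltOp_eq_bellmanOp β sinkInd s
    exact (M.sinkInd_le_tiltOp β a s).trans ha.le

variable [DecidableEq S] [Fintype A] [DecidableEq A] [Nonempty A] {M : SinkMDP S A}

/-- A nonnegative fixed point of a policy operator that is positive at the sink is positive
everywhere. -/
theorem IsTransient.pos_of_policyOp_eq (hM : M.IsTransient) {β : ℝ} {d : Option S → A}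
    {w : Option S → ℝ} (hw : 0 ≤ w) (hnone : 0 < w none) (hfix : M.policyOp β d w = w)
    (s : Option S) : 0 < w s := by
  obtain ⟨v, -, -, hv⟩ := hM.exists_lyapunov
  by_contra hs
  have hne : (Finset.univ.filter fun s => w s = 0).Nonempty :=
    ⟨s, by simpa using le_antisymm (not_lt.1 hs) (hw s)⟩
  -- At a zero of `w` with least `v`, the fixed-point equation makes every successor a zero too, so
  -- `v` cannot drop in expectation there.
  obtain ⟨x, hx, hmin⟩ := Finset.exists_min_image _ v hne
  simp only [Finset.mem_filter, Finset.mem_univ, true_and] at hx hmin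
  cases x with
  | none => exact hnone.ne' hx
  | some x =>
    have hzero : M.tiltOp β (d (some x)) w (some x) = 0 := (congrFun hfix (some x)).trans hx
    have hterm := (Finset.sum_eq_zero_iff_of_nonneg fun s' _ =>
      mul_nonneg (stdSimplex.zero_le _ s') (mul_nonneg (Real.exp_pos _).le (hw s'))).1 hzero
    have hge : v (some x) ≤ M.tiltOp 0 (d (some x)) v (some x) := by
      rw [tiltOp_zero_eq_expect, ← expect_const (M.p (some x) (d (some x))) (v (some x))]
      refine Finset.sum_le_sum fun s' _ => ?_
      rcases mul_eq_zero.1 (hterm s' (Finset.mem_univ _)) with h | h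
      · simp [h]
      · exact mul_le_mul_of_nonneg_left
          (hmin s' ((mul_eq_zero.1 h).resolve_left (Real.exp_pos _).ne'))
          (stdSimplex.zero_le _ _)
    linarith [hv x (d (some x))]

/-- If exponential value iteration started from the indicator of the sink stays bounded by `u`,
then the policy that is greedy with respect to its limit has exponential values that converge to
positive numbers below this limit. -/
theorem IsTransient.exists_policy_tendsto (hM : M.IsTransient) {β : ℝ} {u : Option S → ℝ}
    (hu : ∀ s, Tendsto (fun t => (M.bellmanOp β)^[t] sinkInd s) atTop (nhds (u s))) :
    ∃ (d : Option S → A) (w : Option S → ℝ), (∀ s, 0 < w s) ∧ w ≤ u ∧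
      ∀ s, Tendsto (fun t => (M.policyOp β d)^[t] 1 s) atTop (nhds (w s)) := by
  have hle : ∀ t, (M.bellmanOp β)^[t] sinkInd ≤ u := fun t s =>
    Monotone.ge_of_tendsto (f := fun t => (M.bellmanOp β)^[t] sinkInd s)
      (fun i j h => M.monotone_iterate_bellmanOp β h s) (hu s) t
  -- With finitely many actions, if all failed at the limit, all would fail at some finite iterate,
  -- including the minimizing one.
  have hgreedy : ∀ s, ∃ a, M.tiltOp β a u s ≤ u s := by
    intro s
    by_contra! hcon
    have hev : ∀ᶠ t in atTop, ∀ a, u s < M.tiltOp β a ((M.bellmanOp β)^[t] sinkInd) s :=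
      eventually_all.2 fun a => (M.tendsto_tiltOp β a s hu).eventually_const_lt (hcon a)
    obtain ⟨t, ht⟩ := hev.exists
    obtain ⟨a, ha⟩ := M.exists_tiltOp_eq_bellmanOp β ((M.bellmanOp β)^[t] sinkInd) s
    have h1 := hle (t + 1) s
    rw [Function.iterate_succ_apply', ← ha] at h1
    exact absurd (ht a) (not_lt.2 h1)
  choose d hd using hgreedy
  have hmono := M.monotone_iterate_policyOp β d
  have hbd : ∀ t, (M.policyOp β d)^[t] sinkInd ≤ u := by
    intro t
    induction t with
    | zero => exact hle 0
    | succ t ih =>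
      rw [Function.iterate_succ_apply']
      exact fun s => (M.tiltOp_mono β (d s) ih s).trans (hd s)
  set w : Option S → ℝ := fun s => ⨆ t, (M.policyOp β d)^[t] sinkInd s with hw
  have hlim : ∀ s, Tendsto (fun t => (M.policyOp β d)^[t] sinkInd s) atTop (nhds (w s)) :=
    fun s => tendsto_atTop_ciSup (fun i j h => hmono h s)
      ⟨u s, Set.forall_mem_range.2 fun t => hbd t s⟩
  have hw0 : 0 ≤ w := fun s => ge_of_tendsto' (hlim s) fun t =>
    le_trans (by cases s <;> simp [sinkInd]) (hmono (Nat.zero_le t) s)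
  have hwnone : w none = 1 := by simp [hw, iterate_policyOp_none, sinkInd]
  have hfix : M.policyOp β d w = w := funext fun s => by
    refine tendsto_nhds_unique (M.tendsto_tiltOp β (d s) s hlim) ?_
    refine ((tendsto_add_atTop_iff_nat 1).2 (hlim s)).congr fun t => ?_
    rw [Function.iterate_succ_apply']
    rfl
  have hpos := hM.pos_of_policyOp_eq hw0 (by rw [hwnone]; exact one_pos) hfix
  refine ⟨d, w, hpos, fun s => le_of_tendsto' (hlim s) fun t => hbd t s, ?_⟩
  have hfixt : ∀ t, (M.policyOp β d)^[t] w = w := fun t => Function.iterate_fixed hfix t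
  obtain ⟨x, hx⟩ := Finite.exists_min w
  -- As `w` is fixed and bounded away from zero, the unabsorbed contribution is at most a multiple
  -- of `w` minus the iterates of `sinkInd`, which tends to zero.
  have hdom : nonSinkInd ≤ (w x)⁻¹ • (w + (-1 : ℝ) • sinkInd) := by
    intro s
    cases s with
    | none => simp [nonSinkInd, hwnone, sinkInd]
    | some s =>
      simp only [nonSinkInd, sinkInd, Option.elim_some, Pi.smul_apply, Pi.add_apply, smul_eq_mul,
        mul_zero, add_zero]
      rw [← inv_mul_cancel₀ (hpos x).ne']
      exact mul_le_mul_of_nonneg_left (hx _) (inv_pos.2 (hpos x)).le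
  have hrest : ∀ s, Tendsto (fun t => (M.policyOp β d)^[t] nonSinkInd s) atTop (nhds 0) := by
    intro s
    have h1 : Tendsto (fun t => (w x)⁻¹ * (w s + (-1) * (M.policyOp β d)^[t] sinkInd s)) atTop
        (nhds ((w x)⁻¹ * (w s + (-1) * w s))) :=
      (((hlim s).const_mul (-1)).const_add _).const_mul _
    rw [show (w x)⁻¹ * (w s + (-1) * w s) = 0 by ring] at h1
    refine squeeze_zero (fun t => ?_) (fun t => ?_) h1
    · clear h1
      induction t generalizing s with
      | zero => cases s <;> simp [nonSinkInd]
      | succ t ih =>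
        rw [Function.iterate_succ_apply']
        exact M.tiltOp_nonneg β _ ih s
    · have h2 := (M.policyOp_mono β d).iterate t hdom s
      rw [iterate_policyOp_smul, iterate_policyOp_add, iterate_policyOp_smul, hfixt] at h2
      exact h2
  intro s
  have h := (hlim s).add (hrest s)
  rw [add_zero] at h
  refine h.congr fun t => ?_
  rw [← sinkInd_add_nonSinkInd, iterate_policyOp_add]
  rfl

/-- Exponential value iteration either diverges or dominates the exponential values of some
stationary deterministic policy. -/
theorem IsTransient.expect_iterate_dichotomy (hM : M.IsTransient) (β : ℝ)
    {η : stdSimplex ℝ (Option S)} (hη : ∀ s : S, 0 < η (some s)) :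
    Tendsto (fun t => expect η ((M.bellmanOp β)^[t] sinkInd)) atTop atTop ∨
      ∃ (d : Option S → A) (l l' : ℝ), 0 < l ∧ l ≤ l' ∧
        Tendsto (fun t => expect η ((M.policyOp β d)^[t] 1)) atTop (nhds l) ∧
        Tendsto (fun t => expect η ((M.bellmanOp β)^[t] sinkInd)) atTop (nhds l') := by
  have hmono := M.monotone_iterate_bellmanOp β
  have hnonneg : ∀ t, 0 ≤ (M.bellmanOp β)^[t] sinkInd := fun t =>
    le_trans (fun s => by cases s <;> simp [sinkInd]) (hmono (Nat.zero_le t))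
  have hconv := fun s => tendsto_atTop_of_monotone
    (f := fun t => (M.bellmanOp β)^[t] sinkInd s) fun i j h => hmono h s
  by_cases hall : ∀ s, ∃ l, Tendsto (fun t => (M.bellmanOp β)^[t] sinkInd s) atTop (nhds l)
  · right
    choose u hu using hall
    obtain ⟨d, w, hw, hwu, hlim⟩ := hM.exists_policy_tendsto hu
    refine ⟨d, expect η w, expect η u, ?_, expect_mono η hwu,
      tendsto_finsetSum _ fun s _ => (hlim s).const_mul _,
      tendsto_finsetSum _ fun s _ => (hu s).const_mul _⟩
    -- Writing `w` as `exp (log w)` gives positivity of its expectation.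
    have h1 := expect_exp_pos η fun s => Real.log (w s)
    simpa only [Real.exp_log (hw _)] using h1
  · left
    push Not at hall
    obtain ⟨s, hs⟩ := hall
    have hdiv := (hconv s).resolve_right fun ⟨l, hl⟩ => hs l hl
    cases s with
    | none =>
      -- The sink value is constantly `1`, so divergence occurs at a non-sink state, which has
      -- positive initial mass.
      refine absurd ?_ (hs 1)
      refine tendsto_const_nhds.congr fun t => ?_
      induction t with
      | zero => rfl
      | succ t ih =>
        rw [Function.iterate_succ_apply', ih, bellmanOp]
        simp [tiltOp_none]
    | some s =>
      refine tendsto_atTop_mono (fun t => ?_) (hdiv.const_mul_atTop (hη s))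
      exact Finset.single_le_sum
        (f := fun s => η s * (M.bellmanOp β)^[t] sinkInd s)
        (fun s' _ => mul_nonneg (stdSimplex.zero_le _ _) (hnonneg t s')) (Finset.mem_univ (some s))

end ValueIteration

end SinkMDP

/-! ### Optimality of stationary deterministic policies -/

/-- The supremum in the definition of `evar` is, up to an arbitrarily small error, attained on a
finite set of risk levels that depends only on an upper bound on the expectation. -/
theorem exists_finset_evar_le {α : ℝ} (hα : α ∈ Set.Ioo (0 : ℝ) 1) (C : ℝ) {c' c : ℝ}
    (hc : c' < c) :
    ∃ B : Finset ℝ, (∀ β ∈ B, 0 < β) ∧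
      ∀ {Ω : Type*} [Fintype Ω] (q : stdSimplex ℝ Ω) (X : Ω → ℝ), expect q X ≤ C →
        (∀ β ∈ B, erm β q X + β⁻¹ * Real.log α ≤ c') → evar α q X ≤ c := by
  have hlog : Real.log α < 0 := Real.log_neg hα.1 hα.2
  set δ : ℝ := (c - c') / -Real.log α with hδ
  have hδ0 : 0 < δ := div_pos (sub_pos.2 hc) (neg_pos.2 hlog)
  have hδlog : δ * Real.log α = c' - c := by
    rw [hδ, div_neg, neg_mul, div_mul_cancel₀ _ hlog.ne, neg_sub]
  obtain ⟨N, hN⟩ := exists_nat_ge ((C - c) / (c - c'))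
  have hN' : C - c ≤ N * (c - c') := (div_le_iff₀ (sub_pos.2 hc)).1 hN
  -- The grid is uniform in `β⁻¹`: its step `δ` changes the `log α` term by exactly `c - c'`, and
  -- beyond `N * δ` that term alone brings the bound `C` below `c`.
  refine ⟨(Finset.range N).image fun i : ℕ => (((i : ℝ) + 1) * δ)⁻¹, ?_, ?_⟩
  · intro β hβ
    obtain ⟨i, -, rfl⟩ := Finset.mem_image.1 hβ
    positivity
  · intro Ω _ q X hX hB
    refine iSup_le fun ⟨β, hβ⟩ => EReal.coe_le_coe_iff.2 ?_
    have hx : 0 < β⁻¹ := inv_pos.2 hβ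
    set i := ⌊β⁻¹ / δ⌋₊ with hi
    have hi1 : i * δ ≤ β⁻¹ := (le_div_iff₀ hδ0).1 (Nat.floor_le (div_pos hx hδ0).le)
    have hi2 : β⁻¹ ≤ (i + 1) * δ := ((div_lt_iff₀ hδ0).1 (Nat.lt_floor_add_one _)).le
    have hilog : β⁻¹ * Real.log α ≤ i * (c' - c) := by
      rw [← hδlog, ← mul_assoc]
      exact mul_le_mul_of_nonpos_right hi1 hlog.le
    by_cases hiN : i < N
    · have h1 := hB _ (Finset.mem_image_of_mem _ (Finset.mem_range.2 hiN))
      have h2 : erm β q X ≤ erm (((i : ℝ) + 1) * δ)⁻¹ q X :=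
        erm_antitone q (by positivity) (inv_le_of_inv_le₀ hβ hi2) X
      rw [inv_inv, mul_assoc, hδlog] at h1
      change erm β q X + β⁻¹ * Real.log α ≤ c
      linarith
    · have h1 : (N : ℝ) * (c - c') ≤ i * (c - c') :=
        mul_le_mul_of_nonneg_right (by exact_mod_cast not_lt.1 hiN) (sub_pos.2 hc).le
      have h2 := erm_le_expect q hβ X
      change erm β q X + β⁻¹ * Real.log α ≤ c
      linarith

namespace SinkMDP

variable {S A : Type*} [Fintype S] [DecidableEq S] [Fintype A] [DecidableEq A] [Nonempty A]
  {M : SinkMDP S A}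

/-- For each risk level, the entropic risk of an arbitrary policy is eventually dominated by any
number above the objectives of all stationary deterministic policies. -/
theorem IsTransient.eventually_erm_le (hM : M.IsTransient) (hμ : ∀ s : S, 0 < M.μ (some s))
    (α : ℝ) {β : ℝ} (hβ : 0 < β) {c : ℝ}
    (hc : ∀ d : Option S → A, M.evarObjective α (stationary d) < c) (π : HRPolicy S A) :
    ∀ᶠ t : ℕ in atTop, erm β (M.law π M.μ (t + 1)) (fun h => M.totalReward h) +
      β⁻¹ * Real.log α ≤ c := by
  have hsink : (sinkInd : Option S → ℝ) ≤ 1 := fun s => by cases s <;> simp [sinkInd]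
  have hlow : ∀ t, expect M.μ ((M.bellmanOp β)^[t] sinkInd) ≤ M.tilted β π M.μ t 1 := fun t =>
    (M.le_tilted β π M.μ t sinkInd).trans (M.tilted_mono β π M.μ t hsink)
  have herm : ∀ t, 0 < expect M.μ ((M.bellmanOp β)^[t] sinkInd) →
      erm β (M.law π M.μ t) (fun h => M.totalReward h) ≤
        -β⁻¹ * Real.log (expect M.μ ((M.bellmanOp β)^[t] sinkInd)) := fun t ht => by
    rw [erm_law]
    exact mul_le_mul_of_nonpos_left (Real.log_le_log ht (hlow t))
      (neg_nonpos.2 (inv_pos.2 hβ).le)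
  suffices hev : ∀ᶠ t : ℕ in atTop, erm β (M.law π M.μ t) (fun h => M.totalReward h) +
      β⁻¹ * Real.log α ≤ c from (tendsto_add_atTop_nat 1).eventually hev
  rcases hM.expect_iterate_dichotomy β hμ with hdiv | ⟨d, l, l', hl, hll', hd, hu⟩
  · have h1 : Tendsto (fun t => -β⁻¹ * Real.log (expect M.μ ((M.bellmanOp β)^[t] sinkInd)))
        atTop atBot :=
      (Real.tendsto_log_atTop.comp hdiv).const_mul_atTop_of_neg (neg_lt_zero.2 (inv_pos.2 hβ))
    filter_upwards [h1.eventually_le_atBot (c - β⁻¹ * Real.log α), hdiv.eventually_gt_atTop 0]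
      with t ht hpos
    linarith [herm t hpos]
  · have hl' : 0 < l' := hl.trans_le hll'
    -- EVaR dominates its term at this `β` at every horizon, so the limiting ERM term bounds the
    -- objective of `d` from below.
    have hobj : ((-β⁻¹ * Real.log l + β⁻¹ * Real.log α : ℝ) : EReal) ≤
        M.evarObjective α (stationary d) := by
      have h1 : Tendsto (fun t => ((-β⁻¹ * Real.log (expect M.μ ((M.policyOp β d)^[t + 1] 1)) +
          β⁻¹ * Real.log α : ℝ) : EReal)) atTop
          (nhds ((-β⁻¹ * Real.log l + β⁻¹ * Real.log α : ℝ) : EReal)) :=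
        (continuous_coe_real_ereal.tendsto _).comp
          (((((tendsto_add_atTop_iff_nat 1).2 hd).log hl.ne').const_mul _).add_const _)
      rw [← h1.liminf_eq]
      refine liminf_le_liminf (Eventually.of_forall fun t => ?_)
      rw [← tilted_stationary, ← erm_law]
      exact le_iSup (fun b : {b : ℝ // 0 < b} => ((erm b.1 (M.law (stationary d) M.μ (t + 1))
        (fun h => M.totalReward h) + b.1⁻¹ * Real.log α : ℝ) : EReal)) ⟨β, hβ⟩
    have hlt : -β⁻¹ * Real.log l + β⁻¹ * Real.log α < c :=
      EReal.coe_lt_coe_iff.1 (hobj.trans_lt (hc d))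
    have hlt' : -β⁻¹ * Real.log l' + β⁻¹ * Real.log α < c := by
      have := mul_le_mul_of_nonpos_left (Real.log_le_log hl hll')
        (neg_nonpos.2 (inv_pos.2 hβ).le)
      linarith
    have h1 : Tendsto (fun t => -β⁻¹ * Real.log (expect M.μ ((M.bellmanOp β)^[t] sinkInd)) +
        β⁻¹ * Real.log α) atTop (nhds (-β⁻¹ * Real.log l' + β⁻¹ * Real.log α)) :=
      ((hu.log hl'.ne').const_mul _).add_const _
    filter_upwards [h1.eventually_lt_const hlt', hu.eventually_const_lt hl'] with t ht hpos
    linarith [herm t hpos]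

/-- A number above the objectives of all stationary deterministic policies is an upper bound on
the objective of every policy. -/
theorem IsTransient.evarObjective_le (hM : M.IsTransient) (hμ : ∀ s : S, 0 < M.μ (some s))
    {α : ℝ} (hα : α ∈ Set.Ioo (0 : ℝ) 1) {c' c : ℝ} (hc : c' < c)
    (hc' : ∀ d : Option S → A, M.evarObjective α (stationary d) < c') (π : HRPolicy S A) :
    M.evarObjective α π ≤ c := by
  obtain ⟨C, hC⟩ := hM.exists_expect_totalReward_le M.μ
  obtain ⟨B, hB0, hB⟩ := exists_finset_evar_le hα C hc
  have hev : ∀ᶠ t : ℕ in atTop, ∀ β ∈ B, erm β (M.law π M.μ (t + 1))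
      (fun h => M.totalReward h) + β⁻¹ * Real.log α ≤ c' :=
    (Finset.eventually_all B).2 fun β hβ => hM.eventually_erm_le hμ α (hB0 β hβ) hc' π
  exact liminf_le_of_frequently_le' (hev.mono fun t ht => hB _ _ (hC π (t + 1)) ht).frequently

end SinkMDP

end TRC

theorem mainTheorem4 {S A : Type*} [Fintype S] [DecidableEq S] [Fintype A] [DecidableEq A]
    [Nonempty A] (M : TRC.SinkMDP S A) (hμ : ∀ s : S, 0 < M.μ (some s))
    (hM : M.IsTransient) (α : ℝ) (hα : α ∈ Set.Ioo (0 : ℝ) 1) :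
    ∃ d : Option S → A,
      M.evarObjective α (TRC.stationary d) = ⨆ π : TRC.HRPolicy S A, M.evarObjective α π := by
  obtain ⟨d, hd⟩ := Finite.exists_max fun d : Option S → A =>
    M.evarObjective α (TRC.stationary d)
  refine ⟨d, le_antisymm (le_iSup (fun π : TRC.HRPolicy S A => M.evarObjective α π) _)
    (iSup_le fun π => le_of_forall_gt_imp_ge_of_dense fun b hb => ?_)⟩
  -- Two reals are needed: `c'` strictly dominates all stationary objectives, and the gap up to `c`
  -- pays for the grid.
  obtain ⟨c, hdc, hcb⟩ := EReal.lt_iff_exists_real_btwn.1 hb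
  obtain ⟨c', hdc', hcc'⟩ := EReal.lt_iff_exists_real_btwn.1 hdc
  exact (hM.evarObjective_le hμ hα (EReal.coe_lt_coe_iff.1 hcc')
    (fun d' => (hd d').trans_lt hdc') π).trans hcb.le
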